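/- Let $X=((X_t)_{t\ge 0},(\mathbb P_i)_{i\in S})$ be a continuous time Markov chain with finite or countable state space $S$, with right continuous paths and standard, honest transition function $P(t)=(p_{ij}(t))_{i,j\in S}$ (stochastic matrices with $P(0)=I$, $P(s+t)=P(s)P(t)$ and $p_{ij}(t)\to p_{ij}(0)$ as $t\to0$), where $\mathbb P_i$ is the law of the chain started at $i$. Suppose that the finite right derivatives $q_{ij}=p_{ij}'(0)$ exist, that the $q$-matrix $Q=(q_{ij})$ is conservative, i.e. $\sum_{j\in S}q_{ij}=0$ for all $i\in S$, and that $X$ is not explosive, i.e. under every $\mathbb P_i$ there are almost surely only finitely many jumps in every bounded time interval. Let $D\subset S$, $E=S\setminus D$, let $T=\inf\{t\ge 0: X_t\in D\}$ (with $\inf\emptyset=\infty$) be the first passage time of $X$ in $D$, and for $i\in E$ let $\eta_i=\sum_{j\in D}q_{ij}$ be the killing rate. If there exists $\alpha>0$ such that $\eta_i=\alpha$ for all $i\in E$, then for every probability distribution $\mu=(\mu_i)_{i\in S}$ with support in $E$, the time $T$ is exponentially distributed with parameter $\alpha$ under $\mathbb P_\mu=\sum_{i\in S}\mu_i\mathbb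 P_i$: that is, $\mathbb P_\mu(T>t)=e^{-\alpha t}$ for all $t\ge 0$. -/

import Mathlib

open MeasureTheory Filter Topology
open scoped NNReal ENNReal

/-- `P` is a standard, honest transition function `P(t) = (p_{ij}(t))` on `S`: every `P(t)` is a
stochastic matrix, `P(0)` is the identity, `P(s + t) = P(s) P(t)`, and `p_{ij}(t) → p_{ij}(0)` as
`t → 0`. -/
structure IsTransitionFunction {S : Type*} (P : ℝ≥0 → S → S → ℝ) : Prop where
  nonneg : ∀ t i j, 0 ≤ P t i j
  hasSum_one : ∀ t i, HasSum (P t i) 1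
  zero_self : ∀ i, P 0 i i = 1
  zero_ne : ∀ i j, i ≠ j → P 0 i j = 0
  chapman_kolmogorov : ∀ s t i j, HasSum (fun k => P s i k * P t k j) (P (s + t) i j)
  standard : ∀ i j, Tendsto (fun t => P t i j) (𝓝 0) (𝓝 (P 0 i j))

/-- `Q` is the (finite) `q`-matrix of `P`: `q_{ij} = p_{ij}'(0)`, a right derivative. -/
def IsQMatrixOf {S : Type*} (Q : S → S → ℝ) (P : ℝ≥0 → S → S → ℝ) : Prop :=
  ∀ i j, HasDerivWithinAt (fun t : ℝ => P t.toNNReal i j) (Q i j) (Set.Ici 0) 0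

/-- `Q` is conservative: every row is summable with sum zero. -/
def IsConservative {S : Type*} (Q : S → S → ℝ) : Prop :=
  ∀ i, HasSum (Q i) 0

/-- `X = ((X_t)_{t ≥ 0}, (ℙ_i)_{i ∈ S})` is a continuous time Markov chain with transition
function `P`: a family of random variables with almost surely right continuous paths (for the
discrete topology of `S`), such that under the probability measure `ℙ_i` the chain starts in `i`
and the Markov property holds, i.e. for `t_0 ≤ t_1 ≤ …` and states `x_0, x_1, …`,
`ℙ_i(X_{t_0} = x_0, …, X_{t_{n+1}} = x_{n+1})
  = ℙ_i(X_{t_0} = x_0, …, X_{t_n} = x_n) p_{x_n x_{n+1}}(t_{n+1} - t_n)`. -/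
structure IsMarkovChain {S Ω : Type*} [MeasurableSpace Ω] (P : ℝ≥0 → S → S → ℝ)
    (X : ℝ≥0 → Ω → S) (ℙ : S → Measure Ω) : Prop where
  transition : IsTransitionFunction P
  measurableSet_eq : ∀ t i, MeasurableSet {ω | X t ω = i}
  isProbabilityMeasure : ∀ i, IsProbabilityMeasure (ℙ i)
  right_continuous : ∀ i, ∀ᵐ ω ∂(ℙ i), ∀ t, ∀ᶠ u in 𝓝[≥] t, X u ω = X t ω
  initial : ∀ i, ∀ᵐ ω ∂(ℙ i), X 0 ω = i
  markov : ∀ (i : S) (n : ℕ) (t : ℕ → ℝ≥0) (x : ℕ → S), Monotone t →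
    ℙ i {ω | ∀ k ≤ n + 1, X (t k) ω = x k} =
      ℙ i {ω | ∀ k ≤ n, X (t k) ω = x k} *
        ENNReal.ofReal (P (t (n + 1) - t n) (x n) (x (n + 1)))

/-- The set of jump times of a path `x`: the times `s` such that `x` is not equal to `x s` just
before `s`. -/
def jumpTimes {S : Type*} (x : ℝ≥0 → S) : Set ℝ≥0 :=
  {s | ¬ ∀ᶠ u in 𝓝[<] s, x u = x s}

/-- The chain is not explosive: under every `ℙ_i`, almost surely, there are only finitely many
jumps in every bounded time interval. -/
def IsNonExplosive {S Ω : Type*} [MeasurableSpace Ω] (X : ℝ≥0 → Ω → S)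
    (ℙ : S → Measure Ω) : Prop :=
  ∀ i, ∀ᵐ ω ∂(ℙ i), ∀ t, (jumpTimes (fun s => X s ω) ∩ Set.Iic t).Finite

/-- The law `ℙ_μ = ∑_i μ_i ℙ_i` of the chain with initial distribution `μ`. -/
noncomputable def initialLaw {S Ω : Type*} [MeasurableSpace Ω] (ℙ : S → Measure Ω)
    (μ : PMF S) : Measure Ω :=
  Measure.sum fun i => μ i • ℙ i

/-- The first passage time `T = inf {t ≥ 0 : X_t ∈ D}`, with `inf ∅ = ⊤`. -/
noncomputable def firstPassageTime {S Ω : Type*} (X : ℝ≥0 → Ω → S) (D : Set S) :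
    Ω → WithTop ℝ≥0 :=
  hittingAfter X D 0

/-- The killing rate `η_i = ∑_{j ∈ D} q_{ij}`. -/
noncomputable def killingRate {S : Type*} (Q : S → S → ℝ) (D : Set S) (i : S) : ℝ :=
  ∑' j : D, Q i j

/-! Write E for the complement of D. All states of E are killed at the same rate α, so from each of
them the chain is still in E after a short time h with probability 1 - αh + o(h). If o(h) were
uniform in the state, survival at the n steps of the grid of mesh t/n would have probability (1 -
αt/n + o(1/n))^n, which tends to exp(-αt).

The error is not uniform when E is infinite. Non-explosion repairs this: up to time t a path takes
finitely many values, so it stays in some finite set K with probability at least 1 - ε, and on K the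
one-step bounds hold uniformly for small h. The Markov property on the grid then traps the survival
probability between exp(-(α+ε)t) - ε and exp(-(α-ε)t) + ε. Right continuity identifies the limit of
the grid events with {T > t}, and ε → 0 finishes the proof. -/

/-! ### One-step survival estimates -/

/-- The probability to be in `A` at time `h` grows at least linearly, with any rate smaller than
the total rate of `A`. -/
theorem eventually_add_mul_le_tsum_indicator {S : Type*} {P : ℝ≥0 → S → S → ℝ} {Q : S → S → ℝ}
    (hP : IsTransitionFunction P) (hQ : IsQMatrixOf Q P) (A : Set S) (j : S) {c κ : ℝ}
    (hc : HasSum (A.indicator (Q j)) c) (hκ : κ < c) :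
    ∀ᶠ h : ℝ≥0 in 𝓝 0, A.indicator 1 j + κ * h ≤ ∑' l, A.indicator (P h j) l := by
  classical
  -- Only finite sums can be differentiated term by term, so the rate is truncated to F; j ∈ F keeps
  -- the value at time 0 correct.
  obtain ⟨F, hjF, hF⟩ : ∃ F : Finset S, j ∈ F ∧ κ < ∑ l ∈ F, A.indicator (Q j) l := by
    have h1 := hc.eventually (lt_mem_nhds hκ)
    have h2 : ∀ᶠ F : Finset S in atTop, {j} ⊆ F := eventually_ge_atTop {j}
    obtain ⟨F, h1, h2⟩ := (h1.and h2).exists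
    exact ⟨F, by simpa using h2, h1⟩
  set q := ∑ l ∈ F, A.indicator (Q j) l with hq
  have hder : HasDerivWithinAt (fun t : ℝ => ∑ l ∈ F, A.indicator (P t.toNNReal j) l) q
      (Set.Ici 0) 0 := by
    refine HasDerivWithinAt.fun_sum fun l _ => ?_
    by_cases hl : l ∈ A
    · simpa [hl] using hQ j l
    · simpa [hl] using hasDerivWithinAt_const (0 : ℝ) (Set.Ici 0) (0 : ℝ)
  have h0 : ∑ l ∈ F, A.indicator (P 0 j) l = A.indicator 1 j := by
    rw [Finset.sum_eq_single j]
    · by_cases hj : j ∈ A <;> simp [hj, hP.zero_self]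
    · intro l _ hl
      by_cases hl' : l ∈ A <;> simp [hl', hP.zero_ne j l hl.symm]
    · exact fun h => absurd hjF h
  have hev := (hasDerivWithinAt_iff_isLittleO.1 hder).def (sub_pos.2 hF)
  have htend : Tendsto (fun h : ℝ≥0 => (h : ℝ)) (𝓝 0) (𝓝[≥] 0) := by
    refine tendsto_nhdsWithin_iff.2 ⟨?_, Eventually.of_forall fun h => h.2⟩
    simpa using (NNReal.continuous_coe.tendsto 0)
  filter_upwards [htend.eventually hev] with h hh
  have hsum : Summable (A.indicator (P h j)) := (hP.hasSum_one h j).summable.indicator A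
  have hle : ∑ l ∈ F, A.indicator (P h j) l ≤ ∑' l, A.indicator (P h j) l :=
    hsum.sum_le_tsum F fun l _ => Set.indicator_nonneg (fun l _ => hP.nonneg h j l) l
  refine le_trans ?_ hle
  simp only [Real.toNNReal_coe, Real.toNNReal_zero, h0, sub_zero, smul_eq_mul, Real.norm_eq_abs,
    NNReal.abs_eq] at hh
  have := (abs_le.1 hh).1
  nlinarith

/-- If the killing rate of `j` is `α`, the one step survival probability is `1 - α h + o(h)`. -/
theorem eventually_survival_bounds {S : Type*} {P : ℝ≥0 → S → S → ℝ} {Q : S → S → ℝ}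
    (hP : IsTransitionFunction P) (hQ : IsQMatrixOf Q P) (hcons : IsConservative Q)
    {D : Set S} {α ε : ℝ} (hε : 0 < ε) {j : S} (hj : j ∈ Dᶜ) (hη : killingRate Q D j = α) :
    ∀ᶠ h : ℝ≥0 in 𝓝 0, 1 - (α + ε) * h ≤ ∑' l, Dᶜ.indicator (P h j) l ∧
      ∑' l, Dᶜ.indicator (P h j) l ≤ 1 - (α - ε) * h := by
  have hD : HasSum (D.indicator (Q j)) α := by
    have h := ((hcons j).summable.indicator D).hasSum
    rwa [← tsum_subtype, ← killingRate, hη] at h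
  -- Conservativity enters here: the row of j, diagonal included, sums to -α over Dᶜ.
  have hE : HasSum (Dᶜ.indicator (Q j)) (-α) := by
    have h := (hcons j).sub hD
    rw [zero_sub] at h
    convert! h using 1
    exact Set.indicator_compl D (Q j)
  -- Only lower bounds are available; the upper bound on survival is the lower bound on the mass of
  -- D, subtracted from 1.
  filter_upwards [eventually_add_mul_le_tsum_indicator hP hQ Dᶜ j hE
      (show -(α + ε) < -α by linarith),
    eventually_add_mul_le_tsum_indicator hP hQ D j hD (show α - ε < α by linarith)] with h h1 h2
  have hs := (hP.hasSum_one h j)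
  have hadd : ∑' l, D.indicator (P h j) l + ∑' l, Dᶜ.indicator (P h j) l = 1 := by
    rw [← (hs.summable.indicator D).tsum_add (hs.summable.indicator Dᶜ), ← hs.tsum_eq]
    exact tsum_congr fun l => Set.indicator_self_add_compl_apply D (P h j) l
  simp only [Set.indicator_of_mem hj, Set.indicator_of_notMem hj, Pi.one_apply] at h1 h2
  constructor <;> linarith

/-! ### The Markov property along a grid -/

/-- The Markov property for events of the past which are not given by a single path. -/
theorem IsMarkovChain.measure_path_inter_step {S Ω : Type*} [Countable S] [MeasurableSpace Ω]
    {P : ℝ≥0 → S → S → ℝ} {X : ℝ≥0 → Ω → S} {ℙ : S → Measure Ω} (hX : IsMarkovChain P X ℙ)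
    (i : S) (n : ℕ) {t : ℕ → ℝ≥0} (ht : Monotone t) (B : Set (Fin (n + 1) → S)) (j : S)
    (L : Set S) :
    ℙ i {ω | (fun k : Fin (n + 1) => X (t k) ω) ∈ B ∧ X (t n) ω = j ∧ X (t (n + 1)) ω ∈ L} =
      ℙ i {ω | (fun k : Fin (n + 1) => X (t k) ω) ∈ B ∧ X (t n) ω = j} *
        ENNReal.ofReal (∑' l, L.indicator (P (t (n + 1) - t n) j) l) := by
  classical
  set Y : Ω → Fin (n + 1) → S := fun ω k => X (t k) ω with hY
  set p := P (t (n + 1) - t n) with hp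
  have hm (s : ℝ≥0) (l : S) : MeasurableSet (X s ⁻¹' {l}) := hX.measurableSet_eq s l
  have hmY (b : Fin (n + 1) → S) : MeasurableSet (Y ⁻¹' {b}) := by
    have : Y ⁻¹' {b} = ⋂ k : Fin (n + 1), X (t k) ⁻¹' {b k} := by
      ext ω; simp [hY, funext_iff]
    rw [this]
    exact MeasurableSet.iInter fun k => hm _ _
  have key (b : Fin (n + 1) → S) (l : S) :
      ℙ i (Y ⁻¹' {b} ∩ (X (t n) ⁻¹' {j} ∩ X (t (n + 1)) ⁻¹' {l})) =
        ℙ i (Y ⁻¹' {b} ∩ X (t n) ⁻¹' {j}) * ENNReal.ofReal (p j l) := by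
    by_cases hb : b (Fin.last n) = j
    -- The path b, continued by l at time n + 1.
    · let x : ℕ → S := fun k => if hk : k < n + 1 then b ⟨k, hk⟩ else l
      have hx (k : ℕ) (hk : k < n + 1) : x k = b ⟨k, hk⟩ := dif_pos hk
      have hxn : x n = j := by rw [hx n n.lt_succ_self]; exact hb
      have hxl : x (n + 1) = l := dif_neg (lt_irrefl _)
      have hYb (ω : Ω) : Y ω = b ↔ ∀ k ≤ n, X (t k) ω = x k := by
        constructor
        · intro h k hk
          rw [hx k (Nat.lt_succ_of_le hk), ← h]
        · intro h
          funext k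
          rw [hY]
          simp only
          rw [h k (Nat.le_of_lt_succ k.2), hx k k.2]
      have h := hX.markov i n t x ht
      rw [hxn, hxl] at h
      convert! h using 2
      · ext ω
        simp only [Set.mem_inter_iff, Set.mem_preimage, Set.mem_singleton_iff, hYb,
          Set.mem_ofPred_eq]
        constructor
        · rintro ⟨h1, -, h3⟩ k hk
          rcases Nat.le_or_eq_of_le_succ hk with hk | rfl
          · exact h1 k hk
          · rw [h3, hxl]
        · intro h
          exact ⟨fun k hk => h k (hk.trans n.le_succ), by rw [h n n.le_succ, hxn],
            by rw [h _ le_rfl, hxl]⟩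
      · congr 1
        ext ω
        simp only [Set.mem_inter_iff, Set.mem_preimage, Set.mem_singleton_iff, hYb,
          Set.mem_ofPred_eq]
        exact ⟨fun h => h.1, fun h => ⟨h, by rw [h n le_rfl, hxn]⟩⟩
    · have he : Y ⁻¹' {b} ∩ X (t n) ⁻¹' {j} = ∅ := by
        ext ω
        simp only [Set.mem_inter_iff, Set.mem_preimage, Set.mem_singleton_iff,
          Set.mem_empty_iff_false, iff_false, not_and]
        rintro rfl h
        exact hb (by simpa [hY] using h)
      rw [← Set.inter_assoc, he]
      simp
  have hsumB (G : Set Ω) (hG : MeasurableSet G) :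
      ℙ i (Y ⁻¹' B ∩ G) = ∑' b : B, ℙ i (Y ⁻¹' {(b : Fin (n + 1) → S)} ∩ G) := by
    have h := tsum_measure_preimage_singleton (μ := (ℙ i).restrict G) B.to_countable
      fun b _ => hmY b
    rw [Measure.restrict_apply' hG] at h
    rw [← h]
    exact tsum_congr fun b => Measure.restrict_apply' hG
  have hmB : MeasurableSet (Y ⁻¹' B) := by
    have : Y ⁻¹' B = ⋃ b ∈ B, Y ⁻¹' {b} := by ext; simp
    rw [this]
    exact MeasurableSet.biUnion B.to_countable fun b _ => hmY b
  have hstep (l : S) : ℙ i (X (t (n + 1)) ⁻¹' {l} ∩ (Y ⁻¹' B ∩ X (t n) ⁻¹' {j})) =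
      ℙ i (Y ⁻¹' B ∩ X (t n) ⁻¹' {j}) * ENNReal.ofReal (p j l) := by
    rw [Set.inter_comm, Set.inter_assoc, hsumB _ ((hm _ _).inter (hm _ _)), hsumB _ (hm _ _),
      ← ENNReal.tsum_mul_right]
    exact tsum_congr fun b => key b l
  have hG : MeasurableSet (Y ⁻¹' B ∩ X (t n) ⁻¹' {j}) := hmB.inter (hm _ _)
  have hsumL := tsum_measure_preimage_singleton
    (μ := (ℙ i).restrict (Y ⁻¹' B ∩ X (t n) ⁻¹' {j})) L.to_countable
      (f := X (t (n + 1))) fun l _ => hm _ l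
  simp only [Measure.restrict_apply' hG, hstep] at hsumL
  rw [ENNReal.tsum_mul_left, tsum_subtype L fun l => ENNReal.ofReal (p j l)] at hsumL
  have hnn : ∀ l, 0 ≤ L.indicator (p j) l :=
    Set.indicator_nonneg fun l _ => hX.transition.nonneg _ _ _
  rw [ENNReal.ofReal_tsum_of_nonneg hnn ((hX.transition.hasSum_one _ j).summable.indicator L)]
  have hind : (fun l => ENNReal.ofReal (L.indicator (p j) l)) =
      L.indicator fun l => ENNReal.ofReal (p j l) := by
    ext l
    by_cases hl : l ∈ L <;> simp [hl]
  rw [hind]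
  refine Eq.trans (congrArg _ ?_) hsumL.symm
  ext ω
  simp only [Set.mem_inter_iff, Set.mem_preimage, Set.mem_singleton_iff, Set.mem_ofPred_eq]
  tauto

theorem IsMarkovChain.measurableSet_preimage {S Ω : Type*} [Countable S] [MeasurableSpace Ω]
    {P : ℝ≥0 → S → S → ℝ} {X : ℝ≥0 → Ω → S} {ℙ : S → Measure Ω} (hX : IsMarkovChain P X ℙ)
    (t : ℝ≥0) (A : Set S) : MeasurableSet (X t ⁻¹' A) := by
  have : X t ⁻¹' A = ⋃ a ∈ A, X t ⁻¹' {a} := by ext; simp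
  rw [this]
  exact MeasurableSet.biUnion A.to_countable fun a _ => hX.measurableSet_eq t a

/-- The event that the path stays in `A` at the times `0, h, …, n h`. -/
def staysOnGrid {S Ω : Type*} (X : ℝ≥0 → Ω → S) (A : Set S) (h : ℝ≥0) (n : ℕ) : Set Ω :=
  {ω | ∀ k : ℕ, k ≤ n → X (k * h) ω ∈ A}

theorem IsMarkovChain.measurableSet_staysOnGrid {S Ω : Type*} [Countable S] [MeasurableSpace Ω]
    {P : ℝ≥0 → S → S → ℝ} {X : ℝ≥0 → Ω → S} {ℙ : S → Measure Ω} (hX : IsMarkovChain P X ℙ)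
    (A : Set S) (h : ℝ≥0) (n : ℕ) : MeasurableSet (staysOnGrid X A h n) := by
  have : staysOnGrid X A h n = ⋂ k : ℕ, ⋂ _ : k ≤ n, X (k * h) ⁻¹' A := by
    ext; simp [staysOnGrid]
  rw [this]
  exact MeasurableSet.iInter fun k => MeasurableSet.iInter fun _ => hX.measurableSet_preimage _ _

/-- Split by the state at step n. The landing set is separate from A because A will be Dᶜ ∩ K while
one-step estimates concern Dᶜ. -/
theorem IsMarkovChain.measure_staysOnGrid_inter {S Ω : Type*} [Countable S] [MeasurableSpace Ω]
    {P : ℝ≥0 → S → S → ℝ} {X : ℝ≥0 → Ω → S} {ℙ : S → Measure Ω} (hX : IsMarkovChain P X ℙ)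
    (i : S) (A E : Set S) (h : ℝ≥0) (n : ℕ) :
    ℙ i (staysOnGrid X A h n ∩ X ((n + 1 : ℕ) * h) ⁻¹' E) =
      ∑' j : A, ℙ i (X (n * h) ⁻¹' {(j : S)} ∩ staysOnGrid X A h n) *
        ENNReal.ofReal (∑' l, E.indicator (P h j) l) := by
  have hmono : Monotone fun k : ℕ => (k : ℝ≥0) * h := fun a b hab => by
    dsimp only; gcongr
  have hG : MeasurableSet (staysOnGrid X A h n ∩ X ((n + 1 : ℕ) * h) ⁻¹' E) :=
    (hX.measurableSet_staysOnGrid A h n).inter (hX.measurableSet_preimage _ E)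
  have hsum := tsum_measure_preimage_singleton
    (μ := (ℙ i).restrict (staysOnGrid X A h n ∩ X ((n + 1 : ℕ) * h) ⁻¹' E)) A.to_countable
      (f := X (n * h)) fun l _ => hX.measurableSet_eq _ l
  simp only [Measure.restrict_apply' hG] at hsum
  have hA : X (n * h) ⁻¹' A ∩ (staysOnGrid X A h n ∩ X ((n + 1 : ℕ) * h) ⁻¹' E) =
      staysOnGrid X A h n ∩ X ((n + 1 : ℕ) * h) ⁻¹' E :=
    Set.inter_eq_right.2 fun ω hω => hω.1 n le_rfl
  rw [hA] at hsum
  rw [← hsum]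
  refine tsum_congr fun j => ?_
  have hstep := hX.measure_path_inter_step i n hmono {b | ∀ k, b k ∈ A} (j : S) E
  have hsub : ((n + 1 : ℕ) : ℝ≥0) * h - n * h = h := by
    rw [Nat.cast_succ, add_mul, one_mul, add_tsub_cancel_left]
  rw [hsub] at hstep
  have hmem (ω : Ω) : (∀ k : Fin (n + 1), X (((k : ℕ) : ℝ≥0) * h) ω ∈ A) ↔
      ω ∈ staysOnGrid X A h n :=
    ⟨fun H k hk => H ⟨k, Nat.lt_succ_of_le hk⟩, fun H k => H k (Nat.le_of_lt_succ k.2)⟩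
  convert! hstep using 2
  · ext ω
    simp only [Set.mem_inter_iff, Set.mem_preimage, Set.mem_singleton_iff, Set.mem_ofPred_eq, hmem]
    tauto
  · congr 1
    ext ω
    simp only [Set.mem_inter_iff, Set.mem_preimage, Set.mem_singleton_iff, Set.mem_ofPred_eq, hmem]
    tauto

theorem IsMarkovChain.measure_staysOnGrid_eq_tsum {S Ω : Type*} [Countable S] [MeasurableSpace Ω]
    {P : ℝ≥0 → S → S → ℝ} {X : ℝ≥0 → Ω → S} {ℙ : S → Measure Ω} (hX : IsMarkovChain P X ℙ)
    (i : S) (A : Set S) (h : ℝ≥0) (n : ℕ) :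
    ℙ i (staysOnGrid X A h n) =
      ∑' j : A, ℙ i (X (n * h) ⁻¹' {(j : S)} ∩ staysOnGrid X A h n) := by
  have h1 := hX.measure_staysOnGrid_inter i A Set.univ h n
  simpa [(hX.transition.hasSum_one h _).tsum_eq] using h1

/-! ### Geometric bounds for grid survival -/

section Grid

variable {S Ω : Type*} [Countable S] [MeasurableSpace Ω]
    {P : ℝ≥0 → S → S → ℝ} {X : ℝ≥0 → Ω → S} {ℙ : S → Measure Ω}

theorem IsMarkovChain.measureReal_staysOnGrid_inter_le (hX : IsMarkovChain P X ℙ) (i : S)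
    {A E : Set S} {h : ℝ≥0} {b : ℝ} (hb0 : 0 ≤ b)
    (hb : ∀ j ∈ A, ∑' l, E.indicator (P h j) l ≤ b) (n : ℕ) :
    (ℙ i).real (staysOnGrid X A h n ∩ X ((n + 1 : ℕ) * h) ⁻¹' E) ≤
      b * (ℙ i).real (staysOnGrid X A h n) := by
  have := hX.isProbabilityMeasure i
  rw [measureReal_def, measureReal_def, ← ENNReal.toReal_ofReal_mul _ _ hb0]
  refine ENNReal.toReal_mono (by finiteness) ?_
  rw [hX.measure_staysOnGrid_inter, hX.measure_staysOnGrid_eq_tsum i A h n,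
    ← ENNReal.tsum_mul_left]
  refine ENNReal.tsum_le_tsum fun j => ?_
  rw [mul_comm]
  gcongr
  exact hb j j.2

theorem IsMarkovChain.le_measureReal_staysOnGrid_inter (hX : IsMarkovChain P X ℙ) (i : S)
    {A E : Set S} {h : ℝ≥0} {a : ℝ} (ha0 : 0 ≤ a)
    (ha : ∀ j ∈ A, a ≤ ∑' l, E.indicator (P h j) l) (n : ℕ) :
    a * (ℙ i).real (staysOnGrid X A h n) ≤
      (ℙ i).real (staysOnGrid X A h n ∩ X ((n + 1 : ℕ) * h) ⁻¹' E) := by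
  have := hX.isProbabilityMeasure i
  rw [measureReal_def, measureReal_def, ← ENNReal.toReal_ofReal_mul _ _ ha0]
  refine ENNReal.toReal_mono (by finiteness) ?_
  rw [hX.measure_staysOnGrid_inter, hX.measure_staysOnGrid_eq_tsum i A h n,
    ← ENNReal.tsum_mul_left]
  refine ENNReal.tsum_le_tsum fun j => ?_
  rw [mul_comm]
  gcongr
  exact ha j j.2

/-- Staying in A includes landing in E at each step, so each step costs a factor b; exits from A
inside E only help. -/
theorem IsMarkovChain.measureReal_staysOnGrid_le_pow (hX : IsMarkovChain P X ℙ) (i : S)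
    {A E : Set S} (hAE : A ⊆ E) {h : ℝ≥0} {b : ℝ} (hb0 : 0 ≤ b)
    (hb : ∀ j ∈ A, ∑' l, E.indicator (P h j) l ≤ b) (n : ℕ) :
    (ℙ i).real (staysOnGrid X A h n) ≤ b ^ n := by
  have := hX.isProbabilityMeasure i
  induction n with
  | zero => simp
  | succ n ih =>
    calc (ℙ i).real (staysOnGrid X A h (n + 1))
        ≤ (ℙ i).real (staysOnGrid X A h n ∩ X ((n + 1 : ℕ) * h) ⁻¹' E) :=
          measureReal_mono fun ω hω => ⟨fun k hk => hω k (hk.trans n.le_succ), hAE (hω _ le_rfl)⟩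
      _ ≤ b * (ℙ i).real (staysOnGrid X A h n) := hX.measureReal_staysOnGrid_inter_le i hb0 hb n
      _ ≤ b * b ^ n := by gcongr
      _ = b ^ (n + 1) := (pow_succ' b n).symm

/-- Losing mass from `E ∩ K` other than at rate `1 - a` per step requires leaving `K`. -/
theorem IsMarkovChain.pow_le_measureReal_staysOnGrid_add (hX : IsMarkovChain P X ℙ) (i : S)
    {E K : Set S} (hi : i ∈ E) {h : ℝ≥0} {a : ℝ} (ha0 : 0 ≤ a) (ha1 : a ≤ 1)
    (ha : ∀ j ∈ E ∩ K, a ≤ ∑' l, E.indicator (P h j) l) (n : ℕ) :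
    a ^ n ≤ (ℙ i).real (staysOnGrid X (E ∩ K) h n) + (ℙ i).real (staysOnGrid X K h n)ᶜ := by
  have := hX.isProbabilityMeasure i
  have hmK := hX.measurableSet_staysOnGrid K h
  have hmA := hX.measurableSet_staysOnGrid (E ∩ K) h
  induction n with
  | zero =>
    have h1 : (ℙ i).real (staysOnGrid X (E ∩ K) h 0 ∪ (staysOnGrid X K h 0)ᶜ) = 1 := by
      rw [← probReal_univ (μ := ℙ i)]
      refine measureReal_congr (eventuallyEq_univ.2 ?_)
      filter_upwards [hX.initial i] with ω hω
      by_cases hK : i ∈ K <;> simp [staysOnGrid, hω, hi, hK]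
    rw [pow_zero, ← h1]
    exact measureReal_union_le _ _
  | succ n ih =>
    have h1 := hX.le_measureReal_staysOnGrid_inter i ha0 ha n
    -- A path that lands in E but outside K is not lost: it moves to the second event.
    have hsub : (staysOnGrid X (E ∩ K) h n ∩ X ((n + 1 : ℕ) * h) ⁻¹' E) ∪ (staysOnGrid X K h n)ᶜ ⊆
        staysOnGrid X (E ∩ K) h (n + 1) ∪ (staysOnGrid X K h (n + 1))ᶜ := by
      rintro ω (⟨hω, hω'⟩ | hω)
      · by_cases hK : X ((n + 1 : ℕ) * h) ω ∈ K
        · left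
          intro k hk
          rcases Nat.le_or_eq_of_le_succ hk with hk | rfl
          · exact hω k hk
          · exact ⟨hω', hK⟩
        · exact Or.inr fun H => hK (H _ le_rfl)
      · exact Or.inr fun H => hω fun k hk => H k (hk.trans n.le_succ)
    have hdisj : Disjoint (staysOnGrid X (E ∩ K) h n ∩ X ((n + 1 : ℕ) * h) ⁻¹' E)
        (staysOnGrid X K h n)ᶜ :=
      Set.disjoint_left.2 fun ω hω hω' => hω' fun k hk => (hω.1 k hk).2
    have h2 := (measureReal_mono (μ := ℙ i) hsub).trans (measureReal_union_le _ _)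
    rw [measureReal_union hdisj (hmK n).compl] at h2
    have h3 : 0 ≤ (ℙ i).real (staysOnGrid X K h n)ᶜ := measureReal_nonneg
    calc a ^ (n + 1) = a * a ^ n := pow_succ' a n
      _ ≤ a * ((ℙ i).real (staysOnGrid X (E ∩ K) h n) + (ℙ i).real (staysOnGrid X K h n)ᶜ) := by
          gcongr
      -- The mass that already left K is multiplied by a ≤ 1 only.
      _ ≤ _ := by nlinarith

end Grid

/-! ### Confinement to a finite set -/

/-- A right continuous path with finitely many jumps takes finitely many values. -/
theorem finite_image_Iic_of_finite_jumpTimes {S : Type*} {x : ℝ≥0 → S}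
    (hx : ∀ t, ∀ᶠ u in 𝓝[≥] t, x u = x t) {t : ℝ≥0} (hJ : (jumpTimes x ∩ Set.Iic t).Finite) :
    (x '' Set.Iic t).Finite := by
  refine ((hJ.insert 0).image x).subset ?_
  rintro _ ⟨s, hs, rfl⟩
  have hfin : (insert 0 (jumpTimes x ∩ Set.Iic t) ∩ Set.Iic s).Finite :=
    (hJ.insert 0).inter_of_left _
  -- σ is the last jump time up to s, or 0 if there is none; the path is constant on [σ, s].
  obtain ⟨σ, ⟨hσJ, hσs⟩, hmax⟩ := hfin.exists_maximal ⟨0, Set.mem_insert _ _, Set.mem_Iic.2 zero_le⟩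
  refine ⟨σ, hσJ, ?_⟩
  let _ : TopologicalSpace S := ⊥
  have : DiscreteTopology S := ⟨rfl⟩
  have hcont : ContinuousOn x (Set.Icc σ s) := by
    intro u hu
    have hev : ∀ᶠ v in 𝓝[Set.Icc σ s] u, x v = x u := by
      rcases hu.1.eq_or_lt with rfl | hlt
      · exact (hx σ).filter_mono (nhdsWithin_mono _ Set.Icc_subset_Ici_self)
      · have hnJ : u ∉ jumpTimes x := fun hju =>
          absurd (hmax ⟨Set.mem_insert_of_mem _ ⟨hju, hu.2.trans hs⟩, hu.2⟩ hlt.le) (not_le.2 hlt)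
        have hleft : ∀ᶠ v in 𝓝[<] u, x v = x u := not_not.1 hnJ
        have : ∀ᶠ v in 𝓝 u, x v = x u := by
          rw [← nhdsLT_sup_nhdsGE]
          exact eventually_sup.2 ⟨hleft, hx u⟩
        exact this.filter_mono nhdsWithin_le_nhds
    exact (tendsto_congr' hev).2 tendsto_const_nhds
  exact isPreconnected_Icc.constant hcont (Set.left_mem_Icc.2 hσs) (Set.right_mem_Icc.2 hσs)

/-- Up to time `t`, a non-explosive chain stays in a finite set with high probability. -/
theorem IsMarkovChain.exists_finset_measureReal_compl_staysOnGrid_le {S Ω : Type*} [Countable S]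
    [MeasurableSpace Ω] {P : ℝ≥0 → S → S → ℝ} {X : ℝ≥0 → Ω → S} {ℙ : S → Measure Ω}
    (hX : IsMarkovChain P X ℙ) (hexp : IsNonExplosive X ℙ) (i : S) (t : ℝ≥0) {δ : ℝ}
    (hδ : 0 < δ) :
    ∃ K : Finset S, ∀ n : ℕ, (ℙ i).real (staysOnGrid X (K : Set S) (t / n) n)ᶜ ≤ δ := by
  have := hX.isProbabilityMeasure i
  let N : Finset S → Set Ω := fun K => ⋃ n : ℕ, (staysOnGrid X (K : Set S) (t / n) n)ᶜ
  have hmeas (K : Finset S) : MeasurableSet (N K) :=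
    MeasurableSet.iUnion fun n => (hX.measurableSet_staysOnGrid _ _ _).compl
  have hanti : Antitone N := fun K L hKL =>
    Set.iUnion_mono fun n => Set.compl_subset_compl.2 fun ω hω k hk => hKL (hω k hk)
  have hnull : ℙ i (⋂ K, N K) = 0 := by
    refine measure_eq_zero_iff_ae_notMem.2 ?_
    filter_upwards [hX.right_continuous i, hexp i] with ω hω hJ hmem
    have hfin := finite_image_Iic_of_finite_jumpTimes hω (hJ t)
    obtain ⟨n, hn⟩ := Set.mem_iUnion.1 (Set.mem_iInter.1 hmem hfin.toFinset)
    refine hn fun k hk => ?_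
    rw [Set.Finite.coe_toFinset]
    refine ⟨k * (t / n), ?_, rfl⟩
    rcases Nat.eq_zero_or_pos n with rfl | hn0
    · simp
    · rw [Set.mem_Iic, mul_div_left_comm]
      exact mul_le_of_le_one_right zero_le (div_le_one_of_le₀ (by exact_mod_cast hk) zero_le)
  have htend := tendsto_measure_iInter_atTop (μ := ℙ i) (fun K => (hmeas K).nullMeasurableSet)
    hanti ⟨∅, measure_ne_top _ _⟩
  rw [hnull] at htend
  have hev := htend.eventually (gt_mem_nhds (ENNReal.ofReal_pos.2 hδ))
  obtain ⟨K, hK⟩ := hev.exists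
  refine ⟨K, fun n => ENNReal.toReal_le_of_le_ofReal hδ.le ((measure_mono ?_).trans hK.le)⟩
  exact Set.subset_iUnion (fun n : ℕ => (staysOnGrid X (K : Set S) (t / n) n)ᶜ) n

/-! ### The passage time seen from the grid -/

theorem lt_firstPassageTime_iff {S Ω : Type*} {X : ℝ≥0 → Ω → S} (D : Set S) {ω : Ω}
    (hω : ∀ t, ∀ᶠ u in 𝓝[≥] t, X u ω = X t ω) (t : ℝ≥0) :
    (t : WithTop ℝ≥0) < firstPassageTime X D ω ↔ ∀ s ≤ t, X s ω ∈ Dᶜ := by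
  constructor
  · intro h s hs
    exact notMem_of_lt_hittingAfter (lt_of_le_of_lt (by exact_mod_cast hs) h) zero_le
  · intro h
    -- Survival through time t gives strict inequality because the path rests at its value at t
    -- until some r > t.
    obtain ⟨r, hr, hr'⟩ : ∃ r > t, ∀ s ∈ Set.Ico t r, X s ω = X t ω := by
      obtain ⟨r, hr, hr'⟩ := (mem_nhdsGE_iff_exists_Ico_subset (a := t)).1 (hω t)
      exact ⟨r, hr, hr'⟩
    refine lt_of_lt_of_le (b := (r : WithTop ℝ≥0)) (by exact_mod_cast hr) ?_
    refine not_lt.1 fun hlt => ?_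
    obtain ⟨s, hs, hsD⟩ := hittingAfter_lt_iff.1 hlt
    rcases le_total s t with hst | hst
    · exact h s hst hsD
    · rw [hr' s ⟨hst, hs.2⟩] at hsD
      exact h t le_rfl hsD

/-- A visit to D at time s lasts for a while after s, so fine grids detect it. -/
theorem eventually_mem_staysOnGrid_iff {S Ω : Type*} {X : ℝ≥0 → Ω → S} (D : Set S) {ω : Ω}
    (hω : ∀ t, ∀ᶠ u in 𝓝[≥] t, X u ω = X t ω) (t : ℝ≥0) :
    ∀ᶠ n : ℕ in atTop, ω ∈ staysOnGrid X Dᶜ (t / n) n ↔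
      (t : WithTop ℝ≥0) < firstPassageTime X D ω := by
  have hle {k n : ℕ} (hk : k ≤ n) : (k : ℝ≥0) * (t / n) ≤ t := by
    rcases Nat.eq_zero_or_pos n with rfl | hn0
    · simp
    · rw [mul_div_left_comm]
      exact mul_le_of_le_one_right zero_le (div_le_one_of_le₀ (by exact_mod_cast hk) zero_le)
  rw [lt_firstPassageTime_iff D hω]
  by_cases h : ∀ s ≤ t, X s ω ∈ Dᶜ
  · exact Eventually.of_forall fun n => iff_of_true (fun k hk => h _ (hle hk)) h
  · have h' := h
    push Not at h'
    obtain ⟨s, hs, hsD⟩ := h'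
    have hst : s / t * t = s := by
      rcases eq_or_ne t 0 with rfl | ht
      · simpa using hs.antisymm zero_le |>.symm
      · exact div_mul_cancel₀ s ht
    -- The first grid point at or after s converges to s from the right.
    have htend : Tendsto (fun n : ℕ => (⌈s / t * n⌉₊ : ℝ≥0) * (t / n)) atTop (𝓝[≥] s) := by
      refine tendsto_nhdsWithin_iff.2 ⟨?_, ?_⟩
      · have h1 : Tendsto (fun n : ℕ => (⌈s / t * n⌉₊ : ℝ≥0) / n) atTop (𝓝 (s / t)) := by
          refine NNReal.tendsto_coe.1 ?_
          have h2 := (tendsto_nat_ceil_mul_div_atTop (R := ℝ) (a := (s / t : ℝ≥0))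
            NNReal.zero_le_coe).comp tendsto_natCast_atTop_atTop
          refine h2.congr fun n => ?_
          have : ((s / t : ℝ≥0) : ℝ) * (n : ℝ) = ((s / t * n : ℝ≥0) : ℝ) := by push_cast; ring
          simp only [Function.comp_apply]
          have hceil : ⌈((s / t * n : ℝ≥0) : ℝ)⌉₊ = ⌈s / t * n⌉₊ := rfl
          rw [this, hceil, NNReal.coe_div, NNReal.coe_natCast, NNReal.coe_natCast]
        have h3 := h1.mul_const t
        rw [hst] at h3
        exact h3.congr fun n => by ring
      · filter_upwards [eventually_gt_atTop 0] with n hn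
        have hn' : (n : ℝ≥0) ≠ 0 := by positivity
        calc s = s / t * n * (t / n) := by
              rw [mul_assoc, mul_div_cancel₀ t hn', hst]
          _ ≤ ⌈s / t * n⌉₊ * (t / n) := by gcongr; exact Nat.le_ceil _
    filter_upwards [htend.eventually (hω s)] with n hn
    refine iff_of_false (fun hG => ?_) h
    refine hG ⌈s / t * n⌉₊ ?_ (by rw [hn]; exact not_not.1 hsD)
    refine Nat.ceil_le.2 (mul_le_of_le_one_left zero_le (div_le_one_of_le₀ hs zero_le))

/-- The first passage time agrees almost surely with an infimum over countably many times. -/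
theorem exists_measurable_firstPassageTime {S Ω : Type*} [Countable S] [MeasurableSpace Ω]
    {P : ℝ≥0 → S → S → ℝ} {X : ℝ≥0 → Ω → S} {ℙ : S → Measure Ω} (hX : IsMarkovChain P X ℙ)
    (D : Set S) : ∃ T : Ω → WithTop ℝ≥0, Measurable T ∧ ∀ ω,
      (∀ t, ∀ᶠ u in 𝓝[≥] t, X u ω = X t ω) → firstPassageTime X D ω = T ω := by
  classical
  obtain ⟨C, hC, hCd⟩ := TopologicalSpace.exists_countable_dense ℝ≥0
  have := hC.to_subtype
  refine ⟨fun ω => ⨅ q : C, if X q ω ∈ D then ((q : ℝ≥0) : WithTop ℝ≥0) else ⊤, ?_, ?_⟩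
  · exact Measurable.iInf fun q =>
      Measurable.ite (hX.measurableSet_preimage q D) measurable_const measurable_const
  · intro ω hω
    refine le_antisymm ?_ ?_
    · refine le_iInf fun q => ?_
      split_ifs with h
      · exact hittingAfter_le_of_mem zero_le h
      · exact le_top
    · refine le_of_forall_gt fun c hc => ?_
      obtain ⟨r, hr, hrc⟩ : ∃ r : ℝ≥0, firstPassageTime X D ω < r ∧ (r : WithTop ℝ≥0) ≤ c := by
        induction c with
        | top =>
          lift firstPassageTime X D ω to ℝ≥0 using hc.ne with T
          exact ⟨T + 1, by exact_mod_cast lt_add_one T, le_top⟩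
        | coe r => exact ⟨r, hc, le_rfl⟩
      obtain ⟨s, hs, hsD⟩ := hittingAfter_lt_iff.1 hr
      obtain ⟨v, hv, hv'⟩ := (mem_nhdsGE_iff_exists_Ico_subset (a := s)).1 (hω s)
      -- The visit to D at s persists until v, so a time of the dense set sees it before r.
      obtain ⟨q, hq, hqC⟩ := hCd.exists_between (lt_min hs.2 hv)
      have hqD : X q ω ∈ D := by
        have : X q ω = X s ω := hv' ⟨hqC.1.le, hqC.2.trans_le (min_le_right _ _)⟩
        rwa [this]
      refine lt_of_le_of_lt (iInf_le _ (⟨q, hq⟩ : C)) ?_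
      rw [if_pos hqD]
      exact lt_of_lt_of_le (by exact_mod_cast hqC.2.trans_le (min_le_left _ _)) hrc

/-! ### The exponential law -/

/-- Starting from a state of `Dᶜ`, the survival probability is exponential. -/
theorem IsMarkovChain.measure_lt_firstPassageTime {S Ω : Type*} [Countable S] [MeasurableSpace Ω]
    {P : ℝ≥0 → S → S → ℝ} {Q : S → S → ℝ} {X : ℝ≥0 → Ω → S} {ℙ : S → Measure Ω}
    (hX : IsMarkovChain P X ℙ) (hQ : IsQMatrixOf Q P) (hcons : IsConservative Q)
    (hexp : IsNonExplosive X ℙ) {D : Set S} {α : ℝ} (hα : 0 < α)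
    (hη : ∀ i ∈ Dᶜ, killingRate Q D i = α) {i : S} (hi : i ∈ Dᶜ) (t : ℝ≥0) :
    ℙ i {ω | (t : WithTop ℝ≥0) < firstPassageTime X D ω} =
      ENNReal.ofReal (Real.exp (-α * t)) := by
  have := hX.isProbabilityMeasure i
  obtain ⟨T, hT, hTeq⟩ := exists_measurable_firstPassageTime hX D
  have hae : ∀ᵐ ω ∂ℙ i, firstPassageTime X D ω = T ω := by
    filter_upwards [hX.right_continuous i] with ω hω using hTeq ω hω
  have hcongr : ℙ i {ω | (t : WithTop ℝ≥0) < firstPassageTime X D ω} = ℙ i {ω | t < T ω} :=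
    measure_congr <| by
      filter_upwards [hae] with ω hω
      exact congrArg (fun x => (t : WithTop ℝ≥0) < x) hω
  rw [hcongr, ← ofReal_measureReal]
  congr 1
  have hlim : Tendsto (fun n : ℕ => (ℙ i).real (staysOnGrid X Dᶜ (t / n) n)) atTop
      (𝓝 ((ℙ i).real {ω | t < T ω})) := by
    refine (ENNReal.tendsto_toReal (measure_ne_top _ _)).comp ?_
    refine tendsto_measure_of_ae_tendsto_indicator atTop (measurableSet_lt measurable_const hT)
      (fun n => hX.measurableSet_staysOnGrid _ _ _) MeasurableSet.univ (measure_ne_top _ _)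
      (Eventually.of_forall fun _ => Set.subset_univ _) ?_
    filter_upwards [hX.right_continuous i, hae] with ω hω hωT
    have h := eventually_mem_staysOnGrid_iff D hω t
    rwa [hωT] at h
  have hgrid : Tendsto (fun n : ℕ => t / (n : ℝ≥0)) atTop (𝓝 0) :=
    tendsto_const_div_atTop_nhds_zero_nat t
  have hpow (β : ℝ) : Tendsto (fun n : ℕ => (1 - β * ((t / n : ℝ≥0) : ℝ)) ^ n) atTop
      (𝓝 (Real.exp (-β * t))) := by
    refine (Real.tendsto_one_add_div_pow_exp (-β * t)).congr fun n => ?_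
    push_cast
    ring
  have hnonneg (β : ℝ) : ∀ᶠ n : ℕ in atTop, 0 ≤ 1 - β * ((t / n : ℝ≥0) : ℝ) := by
    have h1 : Tendsto (fun n : ℕ => 1 - β * ((t / n : ℝ≥0) : ℝ)) atTop (𝓝 (1 - β * (0 : ℝ≥0))) :=
      ((NNReal.tendsto_coe.2 hgrid).const_mul β).const_sub 1
    exact h1.eventually (le_mem_nhds (by simp))
  -- ε serves both as the error in the rate and as the probability of leaving K.
  have hbounds {ε : ℝ} (hε : 0 < ε) :
      Real.exp (-(α + ε) * t) - ε ≤ (ℙ i).real {ω | t < T ω} ∧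
        (ℙ i).real {ω | t < T ω} ≤ Real.exp (-(α - ε) * t) + ε := by
    obtain ⟨K, hK⟩ := hX.exists_finset_measureReal_compl_staysOnGrid_le hexp i t hε
    have hstep : ∀ᶠ n : ℕ in atTop, ∀ j ∈ K, j ∈ Dᶜ →
        1 - (α + ε) * ((t / n : ℝ≥0) : ℝ) ≤ ∑' l, Dᶜ.indicator (P (t / n) j) l ∧
          ∑' l, Dᶜ.indicator (P (t / n) j) l ≤ 1 - (α - ε) * ((t / n : ℝ≥0) : ℝ) := by
      refine (Finset.eventually_all K).2 fun j _ => ?_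
      by_cases hj : j ∈ Dᶜ
      · filter_upwards [hgrid.eventually
          (eventually_survival_bounds hX.transition hQ hcons hε hj (hη j hj))] with n hn _ using hn
      · exact Eventually.of_forall fun n h => absurd h hj
    constructor
    · refine le_of_tendsto_of_tendsto ((hpow (α + ε)).sub_const ε) hlim ?_
      filter_upwards [hstep, hnonneg (α + ε)] with n hn h0
      have h1 := hX.pow_le_measureReal_staysOnGrid_add i (K := (K : Set S)) hi h0
        (sub_le_self _ (by positivity)) (fun j hj => (hn j hj.2 hj.1).1) n
      have h2 : (ℙ i).real (staysOnGrid X (Dᶜ ∩ (K : Set S)) (t / n) n) ≤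
          (ℙ i).real (staysOnGrid X Dᶜ (t / n) n) :=
        measureReal_mono fun ω hω k hk => (hω k hk).1
      linarith [hK n]
    · refine le_of_tendsto_of_tendsto hlim ((hpow (α - ε)).add_const ε) ?_
      filter_upwards [hstep, hnonneg (α - ε)] with n hn h0
      have h1 := hX.measureReal_staysOnGrid_le_pow i (A := Dᶜ ∩ (K : Set S))
        Set.inter_subset_left h0 (fun j hj => (hn j hj.2 hj.1).2) n
      have h2 : (ℙ i).real (staysOnGrid X Dᶜ (t / n) n) ≤
          (ℙ i).real (staysOnGrid X (Dᶜ ∩ (K : Set S)) (t / n) n) +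
            (ℙ i).real (staysOnGrid X (K : Set S) (t / n) n)ᶜ := by
        refine (measureReal_mono fun ω hω => ?_).trans (measureReal_union_le _ _)
        by_cases hωK : ω ∈ staysOnGrid X (K : Set S) (t / n) n
        · exact Or.inl fun k hk => ⟨hω k hk, hωK k hk⟩
        · exact Or.inr hωK
      linarith [hK n]
  have hlow : Tendsto (fun ε : ℝ => Real.exp (-(α + ε) * t) - ε) (𝓝[>] 0)
      (𝓝 (Real.exp (-α * t))) := by
    have h : Continuous fun ε : ℝ => Real.exp (-(α + ε) * t) - ε := by fun_prop
    simpa using (h.tendsto 0).mono_left nhdsWithin_le_nhds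
  have hupp : Tendsto (fun ε : ℝ => Real.exp (-(α - ε) * t) + ε) (𝓝[>] 0)
      (𝓝 (Real.exp (-α * t))) := by
    have h : Continuous fun ε : ℝ => Real.exp (-(α - ε) * t) + ε := by fun_prop
    simpa using (h.tendsto 0).mono_left nhdsWithin_le_nhds
  exact le_antisymm
    (ge_of_tendsto hupp (eventually_mem_nhdsWithin.mono fun ε hε => (hbounds hε).2))
    (le_of_tendsto hlow (eventually_mem_nhdsWithin.mono fun ε hε => (hbounds hε).1))

/-- Average the exponential law over the starting state. Paths are right continuous only almost
surely, hence almost everywhere measurability. -/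
theorem mainTheorem5 {S Ω : Type*} [Countable S] [MeasurableSpace Ω]
    (P : ℝ≥0 → S → S → ℝ) (Q : S → S → ℝ) (X : ℝ≥0 → Ω → S) (ℙ : S → Measure Ω)
    (hX : IsMarkovChain P X ℙ) (hQ : IsQMatrixOf Q P) (hcons : IsConservative Q)
    (hexp : IsNonExplosive X ℙ)
    (D : Set S) (α : ℝ) (hα : 0 < α) (hη : ∀ i ∈ Dᶜ, killingRate Q D i = α)
    (μ : PMF S) (hμ : μ.support ⊆ Dᶜ) :
    AEMeasurable (firstPassageTime X D) (initialLaw ℙ μ) ∧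
      ∀ t : ℝ≥0, initialLaw ℙ μ {ω | (t : WithTop ℝ≥0) < firstPassageTime X D ω} =
        ENNReal.ofReal (Real.exp (-α * t)) := by
  obtain ⟨T, hT, hTeq⟩ := exists_measurable_firstPassageTime hX D
  have hae : firstPassageTime X D =ᵐ[initialLaw ℙ μ] T := by
    refine Measure.ae_sum_iff.2 fun i => Measure.ae_smul_measure ?_ _
    filter_upwards [hX.right_continuous i] with ω hω using hTeq ω hω
  refine ⟨⟨T, hT, hae⟩, fun t => ?_⟩
  rw [initialLaw, Measure.sum_apply_of_countable]
  have hterm (i : S) : (μ i • ℙ i) {ω | (t : WithTop ℝ≥0) < firstPassageTime X D ω} =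
      μ i * ENNReal.ofReal (Real.exp (-α * t)) := by
    rw [Measure.smul_apply, smul_eq_mul]
    by_cases hi : μ i = 0
    · rw [hi, zero_mul, zero_mul]
    · rw [hX.measure_lt_firstPassageTime hQ hcons hexp hα hη (hμ ((μ.mem_support_iff i).2 hi))]
  simp_rw [hterm]
  rw [ENNReal.tsum_mul_right, μ.tsum_coe, one_mul]
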